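/- Let $p\ge 1$ be an integer and let $\mathcal S$ be a graded manifold, i.e. a Hausdorff second countable space with a sheaf of $\mathbb Z_{\ge 0}$-graded, graded commutative real algebras (the functions) that is locally isomorphic to $C^\infty(U)\otimes S(V)$ with $U\subset\mathbb R^n$ open and $V$ a finite-dimensional, positively graded vector space. Vector fields of degree $n$ are the graded derivations of degree $n$ of the functions, and the Euler field $\xi$ is the vector field of degree $0$ with $\xi(f)=kf$ for $f$ of degree $k$. Differential forms carry the Bernstein–Leites signs (governed by the total degree, i.e. the degree as a function plus the order as a form); $\mathrm d$ is the de Rham differential, $\iota_X$ is the contraction with $\iota_X\mathrm df=X(f)$, a graded derivation of total degree $\deg X-1$, and $\mathcal L_X=\iota_X\mathrm d+(-1)^{\deg X}\mathrm d\,\iota_X$. Let $Q$ be a vector field of degree $1$ on $\mathcal S$ with $Q^2=0$, and let $\omega$ be a symplectic form of degree $p$ compatible with $Q$: a $2$-form with $\mathrm d\omega=0$, $\mathcal L_\xi\omega=p\,\omega$, $\mathcal L_Q\omega=0$, that is non-degenerate, i.e. $X\mapsto\iota_X\omega$ is a bijection from vector fields of degree $m-p$ onto $1$-forms of degree $m$,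 for every $m$. For a function $h$ of degree $q$ let $X_h$ be its Hamiltonian vector field, the vector field of degree $q-p$ with $\iota_{X_h}\omega=(-1)^{q+1}\mathrm dh$, and let $\{h,g\}=X_h(g)$ be the Poisson bracket, for which $[X_h,X_g]=X_{\{h,g\}}$. Let $Q_{T\mathcal S}=\mathrm d+\mathcal L_Q$ be the total differential on $\Omega(\mathcal S)$. Put $$\alpha=\frac1p\,\iota_\xi\omega,\qquad \mathcal Q=\frac{p}{p+1}(-1)^p\,\iota_Q\alpha,\qquad \hat\alpha=\alpha+\frac{(-1)^p}{p}\,\mathcal Q .$$ Then: 1. $\omega=\mathrm d\alpha$. 2. $\mathcal Q$ is a function of degree $p+1$, and $Q=X_{\mathcal Q}$, that is, $\iota_Q\omega=(-1)^p\,\mathrm d\mathcal Q$; moreover $\{\mathcal Q,\mathcal Q\}=0$. 3. $\hat\alpha=\frac1p\left(1+\frac1{p+1}\iota_Q\right)\iota_\xi\omega$. 4. $\omega$ is $Q_{T\mathcal S}$-exact: $\omega=Q_{T\mathcal S}(\hat\alpha)$. -/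

import Mathlib

open TopologicalSpace DirectSum

noncomputable section

/-! ### Cartan calculus of a graded commutative algebra

Gradings are indexed by `ℤ` so that degrees of vector fields may be negative; signs are governed by
the total degree (degree of functions plus order of forms). -/

/-- The sign `(-1)^n`. -/
def gsign (n : ℤ) : ℝ := (-1) ^ n

/-- Graded commutativity: `f g = (-1)^{|f||g|} g f`. -/
class GradedComm {A : Type*} [Ring A] [Algebra ℝ A] (𝒜 : ℤ → Submodule ℝ A) : Prop where
  comm : ∀ {i j : ℤ} {f g : A}, f ∈ 𝒜 i → g ∈ 𝒜 j → f * g = gsign (i * j) • (g * f)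

namespace GradedCartan

theorem gsign_add (m n : ℤ) : gsign (m + n) = gsign m * gsign n :=
  zpow_add₀ (by norm_num) m n

theorem gsign_even {n : ℤ} (h : Even n) : gsign n = 1 := h.neg_one_zpow

theorem gsign_odd {n : ℤ} (h : Odd n) : gsign n = -1 := h.neg_one_zpow

theorem gsign_congr {m n : ℤ} (h : Even (m - n)) : gsign m = gsign n := by
  have : m = (m - n) + n := by ring
  rw [this, gsign_add, gsign_even h, one_mul]

section

variable {A : Type*} [Ring A] [Algebra ℝ A] (𝒜 : ℤ → Submodule ℝ A)

/-- Vector fields of degree `n`: graded derivations of degree `n`. -/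
def VF (n : ℤ) : Submodule ℝ (Module.End ℝ A) where
  carrier := {X | (∀ k, ∀ f ∈ 𝒜 k, X f ∈ 𝒜 (k + n)) ∧
    ∀ k, ∀ f ∈ 𝒜 k, ∀ g, X (f * g) = X f * g + gsign (n * k) • (f * X g)}
  zero_mem' := by simp
  add_mem' := by
    rintro X Y ⟨hX, hX'⟩ ⟨hY, hY'⟩
    refine ⟨fun k f hf => add_mem (hX k f hf) (hY k f hf), fun k f hf g => ?_⟩
    simp only [LinearMap.add_apply, hX' k f hf, hY' k f hf, add_mul, mul_add, smul_add]
    abel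
  smul_mem' := by
    rintro c X ⟨hX, hX'⟩
    refine ⟨fun k f hf => Submodule.smul_mem _ _ (hX k f hf), fun k f hf g => ?_⟩
    simp only [LinearMap.smul_apply, hX' k f hf, smul_add, smul_mul_assoc, mul_smul_comm]
    rw [smul_comm]

/-- Homogeneous vector fields, together with their degree. -/
abbrev HVF := Σ n : ℤ, VF 𝒜 n

variable {𝒜}

/-- The graded commutator `[X, Y] = X Y - (-1)^{|X||Y|} Y X`. -/
def bracket (X Y : HVF 𝒜) : HVF 𝒜 :=
  ⟨X.1 + Y.1, (X.2 : Module.End ℝ A) * Y.2 - gsign (X.1 * Y.1) • ((Y.2 : Module.End ℝ A) * X.2), by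
    obtain ⟨m, X, hX, hX'⟩ := X
    obtain ⟨n, Y, hY, hY'⟩ := Y
    refine ⟨fun k f hf => ?_, fun k f hf g => ?_⟩
    · refine sub_mem ?_ (Submodule.smul_mem _ _ ?_)
      · have := hX _ _ (hY k f hf)
        rwa [show k + n + m = k + (m + n) by ring] at this
      · have := hY _ _ (hX k f hf)
        rwa [show k + m + n = k + (m + n) by ring] at this
    · simp only [LinearMap.sub_apply, LinearMap.smul_apply, Module.End.mul_apply,
        hX' k f hf, hY' k f hf, map_add, map_smul, hX' _ _ (hY k f hf), hY' _ _ (hX k f hf)]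
      simp only [sub_mul, mul_sub, smul_add, smul_sub, smul_smul, smul_mul_assoc, mul_smul_comm,
        ← gsign_add]
      rw [gsign_congr (m := m * n + n * (k + m)) (n := n * k) (by
          rw [show m * n + n * (k + m) - n * k = 2 * (m * n) by ring]; exact even_two_mul _),
        show m * (k + n) = m * n + m * k by ring,
        show n * k + m * k = (m + n) * k by ring,
        show m * n + (m * k + n * k) = (m + n) * k + m * n by ring]
      abel⟩

/-- The product `f X` of a function of degree `k` and a vector field. -/
def fmul [GradedComm 𝒜] {k : ℤ} (f : 𝒜 k) [GradedAlgebra 𝒜] (X : HVF 𝒜) : HVF 𝒜 :=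
  ⟨k + X.1, LinearMap.mulLeft ℝ (f : A) * (X.2 : Module.End ℝ A), by
    obtain ⟨n, X, hX, hX'⟩ := X
    refine ⟨fun j g hg => ?_, fun j g hg h => ?_⟩
    · have := SetLike.mul_mem_graded f.2 (hX j g hg)
      rwa [show k + (j + n) = j + (k + n) by ring] at this
    · simp only [Module.End.mul_apply, LinearMap.mulLeft_apply, hX' j g hg, mul_add,
        mul_smul_comm, ← mul_assoc, GradedComm.comm f.2 hg, smul_mul_assoc, smul_smul,
        ← gsign_add]
      rw [show n * j + k * j = (k + n) * j by ring]⟩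

end

section Forms

variable {A : Type*} [Ring A] [Algebra ℝ A] (𝒜 : ℤ → Submodule ℝ A)

/-- Functions of `k` homogeneous vector fields. The value of a `k`-form `η` on `X₁, …, Xₖ` stands
for the iterated contraction `ι_{Xₖ} ⋯ ι_{X₁} η`. -/
abbrev Raw (k : ℕ) := (Fin k → HVF 𝒜) → A

variable {𝒜}

/-- Contraction with `X`. -/
def rawIota (X : HVF 𝒜) (k : ℕ) : Raw 𝒜 (k + 1) →ₗ[ℝ] Raw 𝒜 k where
  toFun η := fun v => η (Fin.cons X v)
  map_add' _ _ := rfl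
  map_smul' _ _ := rfl

/-- The Lie derivative, determined by `L_X f = X f` and `[L_X, ι_Y] = ι_{[X,Y]}`, that is
`ι_Y L_X = (-1)^{|X|(|Y|-1)} (L_X ι_Y - ι_{[X,Y]})`. -/
def rawLie (X : HVF 𝒜) : ∀ k, Raw 𝒜 k → Raw 𝒜 k
  | 0, η => fun v => (X.2 : Module.End ℝ A) (η v)
  | k + 1, η => fun v => gsign (X.1 * ((v 0).1 - 1)) •
      (rawLie X k (rawIota (v 0) k η) (Fin.tail v) -
        rawIota (bracket X (v 0)) k η (Fin.tail v))

/-- The de Rham differential, determined by `ι_X df = X f` and Cartan's formula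
`ι_X d = L_X - (-1)^{|X|} d ι_X`. -/
def rawD : ∀ k, Raw 𝒜 k → Raw 𝒜 (k + 1)
  | 0, η => fun v => ((v 0).2 : Module.End ℝ A) (η (Fin.tail v))
  | k + 1, η => fun v => rawLie (v 0) (k + 1) η (Fin.tail v) -
      gsign (v 0).1 • rawD k (rawIota (v 0) k η) (Fin.tail v)

theorem hvf_ext {X Y : HVF 𝒜} (h : X.1 = Y.1)
    (h' : (X.2 : Module.End ℝ A) = (Y.2 : Module.End ℝ A)) : X = Y := by
  obtain ⟨m, X⟩ := X
  obtain ⟨n, Y⟩ := Y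
  obtain rfl : m = n := h
  obtain rfl : X = Y := Subtype.ext h'
  rfl

theorem raw_ext {k : ℕ} {η ζ : Raw 𝒜 (k + 1)} (h : ∀ X, rawIota X k η = rawIota X k ζ) :
    η = ζ := by
  funext v
  have := congrFun (h (v 0)) (Fin.tail v)
  simpa [rawIota] using this

theorem raw_cons_zero (X : HVF 𝒜) (v : Fin 0 → HVF 𝒜) :
    (Fin.cons X v : Fin 1 → HVF 𝒜) = ![X] := by
  ext i : 1; fin_cases i; rfl

theorem rawIota_rawLie (X Y : HVF 𝒜) (k : ℕ) (η : Raw 𝒜 (k + 1)) :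
    rawIota Y k (rawLie X (k + 1) η) = gsign (X.1 * (Y.1 - 1)) •
      (rawLie X k (rawIota Y k η) - rawIota (bracket X Y) k η) := rfl

theorem rawIota_rawD (X : HVF 𝒜) (k : ℕ) (η : Raw 𝒜 (k + 1)) :
    rawIota X (k + 1) (rawD (k + 1) η) =
      rawLie X (k + 1) η - gsign X.1 • rawD k (rawIota X k η) := rfl

theorem rawIota_rawD_zero (X : HVF 𝒜) (η : Raw 𝒜 0) :
    rawIota X 0 (rawD 0 η) = rawLie X 0 η := rfl

theorem rawLie_add (X : HVF 𝒜) : ∀ k (η ζ : Raw 𝒜 k),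
    rawLie X k (η + ζ) = rawLie X k η + rawLie X k ζ
  | 0, η, ζ => by funext v; simp [rawLie]
  | k + 1, η, ζ => raw_ext fun Y => by
      simp only [rawIota_rawLie, map_add, rawLie_add X k, ← smul_add]
      congr 1; abel

theorem rawLie_smul (X : HVF 𝒜) (c : ℝ) : ∀ k (η : Raw 𝒜 k),
    rawLie X k (c • η) = c • rawLie X k η
  | 0, η => by funext v; simp [rawLie]
  | k + 1, η => raw_ext fun Y => by
      simp only [rawIota_rawLie, map_smul, rawLie_smul X c k, ← smul_sub]
      rw [smul_comm]

theorem rawD_add : ∀ k (η ζ : Raw 𝒜 k), rawD k (η + ζ) = rawD k η + rawD k ζ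
  | 0, η, ζ => by funext v; simp [rawD]
  | k + 1, η, ζ => raw_ext fun Y => by
      simp only [rawIota_rawD, map_add, rawD_add k, rawLie_add, smul_add]
      abel

theorem rawD_smul (c : ℝ) : ∀ k (η : Raw 𝒜 k), rawD k (c • η) = c • rawD k η
  | 0, η => by funext v; simp [rawD]
  | k + 1, η => raw_ext fun Y => by
      simp only [rawIota_rawD, map_smul, rawD_smul c k, rawLie_smul, smul_sub]
      rw [smul_comm]

theorem deg_succ_iff {k : ℕ} {m : ℤ} {η : Raw 𝒜 (k + 1)} :
    (∀ v, η v ∈ 𝒜 (m + ∑ i, (v i).1)) ↔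
      ∀ X : HVF 𝒜, ∀ v, rawIota X k η v ∈ 𝒜 (m + X.1 + ∑ i, (v i).1) := by
  constructor
  · intro h X v
    have := h (Fin.cons X v)
    simpa [rawIota, Fin.sum_univ_succ, ← add_assoc] using this
  · intro h v
    have := h (v 0) (Fin.tail v)
    simpa [rawIota, Fin.sum_univ_succ, ← add_assoc, Fin.tail] using this

theorem deg_rawLie (X : HVF 𝒜) : ∀ {k : ℕ} {m : ℤ} {η : Raw 𝒜 k},
    (∀ v, η v ∈ 𝒜 (m + ∑ i, (v i).1)) → ∀ v, rawLie X k η v ∈ 𝒜 (m + X.1 + ∑ i, (v i).1)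
  | 0, m, η, h => fun v => by
      have := X.2.2.1 _ _ (h v)
      rwa [add_right_comm] at this
  | k + 1, m, η, h => by
      have h' := deg_succ_iff.1 h
      refine deg_succ_iff.2 fun Y v => ?_
      rw [rawIota_rawLie]
      refine Submodule.smul_mem _ _ (sub_mem ?_ ?_)
      · have := deg_rawLie X (h' Y) v
        rwa [add_right_comm m] at this
      · have := h' (bracket X Y) v
        rwa [show m + (bracket X Y).1 = m + X.1 + Y.1 from (add_assoc _ _ _).symm] at this

theorem deg_rawD : ∀ {k : ℕ} {m : ℤ} {η : Raw 𝒜 k},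
    (∀ v, η v ∈ 𝒜 (m + ∑ i, (v i).1)) → ∀ v, rawD k η v ∈ 𝒜 (m + ∑ i, (v i).1)
  | 0, _, _, h => deg_succ_iff.2 fun X v => deg_rawLie X h v
  | _ + 1, _, _, h => deg_succ_iff.2 fun X v =>
      sub_mem (deg_rawLie X h v) (Submodule.smul_mem _ _ (deg_rawD (deg_succ_iff.1 h X) v))

variable [GradedAlgebra 𝒜] [GradedComm 𝒜]

/-- A function of `k` homogeneous vector fields is a differential form if it is linear over
functions in the last argument, and graded symmetric:
`ι_X ι_Y = (-1)^{(|X|-1)(|Y|-1)} ι_Y ι_X`. -/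
def IsForm : ∀ k, Raw 𝒜 k → Prop
  | 0, _ => True
  | 1, η => (∀ (n : ℤ) (X Y : VF 𝒜 n), η ![⟨n, X + Y⟩] = η ![⟨n, X⟩] + η ![⟨n, Y⟩]) ∧
      ∀ (k : ℤ) (f : 𝒜 k) (X : HVF 𝒜), η ![fmul f X] = f * η ![X]
  | k + 2, η => (∀ X, IsForm (k + 1) (rawIota X (k + 1) η)) ∧
      ∀ X Y, rawIota Y k (rawIota X (k + 1) η) =
        gsign ((X.1 - 1) * (Y.1 - 1)) • rawIota X k (rawIota Y (k + 1) η)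

theorem isForm_zero : ∀ k, IsForm k (0 : Raw 𝒜 k)
  | 0 => trivial
  | 1 => ⟨fun _ _ _ => by simp, fun _ _ _ => by simp⟩
  | k + 2 => ⟨fun X => by rw [map_zero]; exact isForm_zero (k + 1), fun X Y => by simp⟩

theorem IsForm.add : ∀ {k} {η ζ : Raw 𝒜 k}, IsForm k η → IsForm k ζ → IsForm k (η + ζ)
  | 0, _, _, _, _ => trivial
  | 1, η, ζ, h, h' => ⟨fun n X Y => by
      simp only [Pi.add_apply, h.1, h'.1]; abel, fun n f X => by
      simp only [Pi.add_apply, h.2, h'.2, mul_add]⟩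
  | k + 2, η, ζ, h, h' => ⟨fun X => by rw [map_add]; exact (h.1 X).add (h'.1 X), fun X Y => by
      simp only [map_add, h.2 X Y, h'.2 X Y, smul_add]⟩

theorem IsForm.smul (c : ℝ) : ∀ {k} {η : Raw 𝒜 k}, IsForm k η → IsForm k (c • η)
  | 0, _, _ => trivial
  | 1, η, h => ⟨fun n X Y => by
      simp only [Pi.smul_apply, h.1, smul_add], fun n f X => by
      simp only [Pi.smul_apply, h.2, mul_smul_comm]⟩
  | k + 2, η, h => ⟨fun X => by rw [map_smul]; exact (h.1 X).smul c, fun X Y => by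
      simp only [map_smul, h.2 X Y]; rw [smul_comm]⟩

theorem IsForm.sub {k} {η ζ : Raw 𝒜 k} (h : IsForm k η) (h' : IsForm k ζ) :
    IsForm k (η - ζ) := by
  rw [sub_eq_add_neg, ← neg_one_smul ℝ ζ]
  exact h.add (h'.smul _)

theorem IsForm.iota (X : HVF 𝒜) : ∀ {k} {η : Raw 𝒜 (k + 1)}, IsForm (k + 1) η →
    IsForm k (rawIota X k η)
  | 0, _, _ => trivial
  | _ + 1, _, h => h.1 X

theorem IsForm.first_smul (c : ℝ) {X Y : HVF 𝒜} (hd : X.1 = Y.1)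
    (hc : (X.2 : Module.End ℝ A) = c • (Y.2 : Module.End ℝ A)) : ∀ {k} {η : Raw 𝒜 (k + 1)},
    IsForm (k + 1) η → rawIota X k η = c • rawIota Y k η
  | 0, η, h => by
      have e : X = fmul (⟨algebraMap ℝ A c, SetLike.algebraMap_mem_graded 𝒜 c⟩ : 𝒜 0) Y :=
        hvf_ext (by simp [fmul, hd]) (by rw [hc]; ext g; simp [fmul, Algebra.smul_def])
      funext v
      have := h.2 0 (⟨algebraMap ℝ A c, SetLike.algebraMap_mem_graded 𝒜 c⟩ : 𝒜 0) Y
      rw [← e] at this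
      simp only [rawIota, LinearMap.coe_mk, AddHom.coe_mk, Pi.smul_apply, raw_cons_zero, this]
      rw [Algebra.smul_def]
  | k + 1, η, h => raw_ext fun Z => by
      rw [h.2, map_smul, h.2 Y Z, (h.1 Z).first_smul c hd hc, smul_comm, hd]

theorem IsForm.first_add {X Y Z : HVF 𝒜} (hY : X.1 = Y.1) (hZ : X.1 = Z.1)
    (hX : (X.2 : Module.End ℝ A) = (Y.2 : Module.End ℝ A) + (Z.2 : Module.End ℝ A))
    {η : Raw 𝒜 1} (h : IsForm 1 η) : η ![X] = η ![Y] + η ![Z] := by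
  obtain ⟨n, X⟩ := X
  obtain ⟨m, Y⟩ := Y
  obtain ⟨m', Z⟩ := Z
  obtain rfl : n = m := hY
  obtain rfl : n = m' := hZ
  obtain rfl : X = Y + Z := Subtype.ext hX
  exact h.1 n Y Z

theorem isForm_rawLie (X : HVF 𝒜) : ∀ {k} {η : Raw 𝒜 k}, IsForm k η → IsForm k (rawLie X k η)
  | 0, _, _ => trivial
  | 1, η, h => by
      have hL : ∀ Y : HVF 𝒜, rawLie X 1 η ![Y] = gsign (X.1 * (Y.1 - 1)) •
          ((X.2 : Module.End ℝ A) (η ![Y]) - η ![bracket X Y]) := fun Y => by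
        simp [rawLie, rawIota]
      refine ⟨fun n Y Z => ?_, fun k f Y => ?_⟩
      · rw [hL, hL, hL, h.1, IsForm.first_add (X := bracket X ⟨n, Y + Z⟩)
          (Y := bracket X ⟨n, Y⟩) (Z := bracket X ⟨n, Z⟩) rfl rfl
          (by ext g; simp [bracket]; abel) h, map_add, ← smul_add]
        congr 1
        abel
      · obtain ⟨m, X, hX⟩ := X
        have hXf : X f ∈ 𝒜 (k + m) := hX.1 k f f.2
        let W : HVF 𝒜 := ⟨(fmul f (bracket ⟨m, X, hX⟩ Y)).1,
          gsign (m * k) • (fmul f (bracket ⟨m, X, hX⟩ Y)).2⟩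
        have e1 : η ![bracket ⟨m, X, hX⟩ (fmul f Y)] =
            η ![fmul (⟨X f, hXf⟩ : 𝒜 (k + m)) Y] + η ![W] := by
          refine IsForm.first_add (by simp [bracket, fmul]; ring)
            (by simp [bracket, fmul, W]; ring) ?_ h
          ext g
          change X (f * (Y.2 : Module.End ℝ A) g) -
            gsign (m * (k + Y.1)) • (f * (Y.2 : Module.End ℝ A) (X g)) =
            X f * (Y.2 : Module.End ℝ A) g + gsign (m * k) • (f * (X ((Y.2 : Module.End ℝ A) g) -
              gsign (m * Y.1) • (Y.2 : Module.End ℝ A) (X g)))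
          simp only [hX.2 k f f.2, smul_sub, mul_sub, mul_smul_comm, smul_smul, ← gsign_add]
          rw [show m * (k + Y.1) = m * k + m * Y.1 by ring]
          abel
        have e2 := congrFun (IsForm.first_smul (X := W)
          (Y := fmul f (bracket ⟨m, X, hX⟩ Y)) (gsign (m * k)) rfl rfl h) Fin.elim0
        simp only [rawIota, LinearMap.coe_mk, AddHom.coe_mk, Pi.smul_apply, raw_cons_zero] at e2
        rw [hL, hL, e1, e2, h.2, h.2, h.2]
        simp only [fmul, hX.2 k f f.2, smul_sub, smul_add, mul_sub, mul_smul_comm,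
          smul_smul, ← gsign_add]
        rw [gsign_congr (m := m * (k + Y.1) - m * 1 + m * k) (n := m * Y.1 - m * 1) (by
          rw [show m * (k + Y.1) - m * 1 + m * k - (m * Y.1 - m * 1) = 2 * (m * k) by ring]
          exact even_two_mul _)]
        abel
  | k + 2, η, h => by
      refine ⟨fun Y => ?_, fun Y Z => ?_⟩
      · rw [rawIota_rawLie]
        exact ((isForm_rawLie X (h.1 Y)).sub (h.1 _)).smul _
      · simp only [rawIota_rawLie, map_smul, map_sub]
        rw [h.2 Y Z, rawLie_smul, h.2 (bracket X Y) Z, h.2 Y (bracket X Z)]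
        simp only [smul_sub, smul_smul, ← gsign_add, bracket]
        have c1 : gsign (X.1 * (Y.1 - 1) + (X.1 + Y.1 - 1) * (Z.1 - 1)) =
            gsign ((Y.1 - 1) * (Z.1 - 1) + (X.1 * (Z.1 - 1) + X.1 * (Y.1 - 1))) := by
          congr 1; ring
        have c2 : gsign (X.1 * (Y.1 - 1) + (X.1 * (Z.1 - 1) + (Y.1 - 1) * (X.1 + Z.1 - 1))) =
            gsign ((Y.1 - 1) * (Z.1 - 1) + X.1 * (Z.1 - 1)) := gsign_congr (by
          rw [show X.1 * (Y.1 - 1) + (X.1 * (Z.1 - 1) + (Y.1 - 1) * (X.1 + Z.1 - 1)) -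
            ((Y.1 - 1) * (Z.1 - 1) + X.1 * (Z.1 - 1)) = 2 * (X.1 * (Y.1 - 1)) by ring]
          exact even_two_mul _)
        have c3 : gsign (X.1 * (Y.1 - 1) + (X.1 * (Z.1 - 1) + (Y.1 - 1) * (Z.1 - 1))) =
            gsign ((Y.1 - 1) * (Z.1 - 1) + (X.1 * (Z.1 - 1) + X.1 * (Y.1 - 1))) := by
          congr 1; ring
        simp only [c1, c2, c3]
        abel

theorem rawIota_bracket_swap (X Y : HVF 𝒜) {k} {η : Raw 𝒜 (k + 1)} (h : IsForm (k + 1) η) :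
    rawIota (bracket Y X) k η = gsign (X.1 * Y.1 + 1) • rawIota (bracket X Y) k η := by
  refine IsForm.first_smul _ (add_comm _ _) ?_ h
  have h1 : gsign (X.1 * Y.1 + 1) = -gsign (X.1 * Y.1) := by
    rw [gsign_add, gsign_odd odd_one, mul_neg_one]
  have h2 : gsign (X.1 * Y.1) * gsign (X.1 * Y.1) = 1 := by
    rw [← gsign_add]; exact gsign_even ⟨_, rfl⟩
  simp only [bracket, h1, smul_sub, neg_smul, smul_smul, neg_mul, h2, one_smul, mul_comm Y.1]
  abel

theorem isForm_rawD : ∀ {k} {η : Raw 𝒜 k}, IsForm k η → IsForm (k + 1) (rawD k η)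
  | 0, η, _ => by
      refine ⟨fun n X Y => ?_, fun k f X => ?_⟩
      · simp only [rawD, Matrix.cons_val_zero, Submodule.coe_add, LinearMap.add_apply]
        congr
      · simp only [rawD, Matrix.cons_val_zero, fmul, Module.End.mul_apply,
          LinearMap.mulLeft_apply]
        congr
  | 1, η, h => by
      refine ⟨fun X => ?_, fun X Y => ?_⟩
      · rw [rawIota_rawD]
        exact (isForm_rawLie X h).sub ((isForm_rawD (h.iota X)).smul _)
      · simp only [rawIota_rawD, rawIota_rawLie, map_sub, map_smul, rawIota_rawD_zero]
        rw [rawIota_bracket_swap X Y h]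
        simp only [smul_sub, smul_smul, ← gsign_add]
        rw [gsign_congr (m := (X.1 - 1) * (Y.1 - 1) + (Y.1 * (X.1 - 1) + (X.1 * Y.1 + 1)))
            (n := X.1 * (Y.1 - 1)) (by
            rw [show (X.1 - 1) * (Y.1 - 1) + (Y.1 * (X.1 - 1) + (X.1 * Y.1 + 1)) -
              X.1 * (Y.1 - 1) = 2 * (X.1 * Y.1 - Y.1 + 1) by ring]
            exact even_two_mul _),
          gsign_congr (m := (X.1 - 1) * (Y.1 - 1) + Y.1 * (X.1 - 1)) (n := X.1 + 1) (by
            rw [show (X.1 - 1) * (Y.1 - 1) + Y.1 * (X.1 - 1) - (X.1 + 1) =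
              2 * (X.1 * Y.1 - X.1 - Y.1) by ring]
            exact even_two_mul _),
          gsign_congr (m := (X.1 - 1) * (Y.1 - 1) + Y.1) (n := X.1 * (Y.1 - 1) + 1) (by
            rw [show (X.1 - 1) * (Y.1 - 1) + Y.1 - (X.1 * (Y.1 - 1) + 1) = 2 * 0 by ring]
            exact even_two_mul _),
          gsign_add X.1 1, gsign_add (X.1 * (Y.1 - 1)) 1, gsign_odd odd_one]
        simp only [mul_neg_one, neg_smul]
        abel
  | k + 2, η, h => by
      refine ⟨fun X => ?_, fun X Y => ?_⟩
      · rw [rawIota_rawD]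
        exact (isForm_rawLie X h).sub ((isForm_rawD (h.1 X)).smul _)
      · simp only [rawIota_rawD, rawIota_rawLie, map_sub, map_smul]
        rw [rawIota_bracket_swap X Y h, h.2 X Y, rawD_smul]
        simp only [smul_sub, smul_smul, ← gsign_add]
        rw [gsign_congr (m := (X.1 - 1) * (Y.1 - 1) + (Y.1 * (X.1 - 1) + (X.1 * Y.1 + 1)))
            (n := X.1 * (Y.1 - 1)) (by
            rw [show (X.1 - 1) * (Y.1 - 1) + (Y.1 * (X.1 - 1) + (X.1 * Y.1 + 1)) -
              X.1 * (Y.1 - 1) = 2 * (X.1 * Y.1 - Y.1 + 1) by ring]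
            exact even_two_mul _),
          gsign_congr (m := (X.1 - 1) * (Y.1 - 1) + Y.1 * (X.1 - 1)) (n := X.1 + 1) (by
            rw [show (X.1 - 1) * (Y.1 - 1) + Y.1 * (X.1 - 1) - (X.1 + 1) =
              2 * (X.1 * Y.1 - X.1 - Y.1) by ring]
            exact even_two_mul _),
          gsign_congr (m := (X.1 - 1) * (Y.1 - 1) + Y.1) (n := X.1 * (Y.1 - 1) + 1) (by
            rw [show (X.1 - 1) * (Y.1 - 1) + Y.1 - (X.1 * (Y.1 - 1) + 1) = 2 * 0 by ring]
            exact even_two_mul _),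
          show X.1 + (Y.1 + (X.1 - 1) * (Y.1 - 1)) =
            (X.1 - 1) * (Y.1 - 1) + (Y.1 + X.1) by ring,
          gsign_add X.1 1, gsign_add (X.1 * (Y.1 - 1)) 1, gsign_odd odd_one]
        simp only [mul_neg_one, neg_smul]
        abel

variable (𝒜)

/-- The `k`-forms of degree `m`. -/
def FormDeg (k : ℕ) (m : ℤ) : Submodule ℝ (Raw 𝒜 k) where
  carrier := {η : Raw 𝒜 k | IsForm k η ∧ ∀ v : Fin k → HVF 𝒜, η v ∈ 𝒜 (m + ∑ i, (v i).1)}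
  zero_mem' := ⟨isForm_zero k, fun _ => zero_mem _⟩
  add_mem' h h' := ⟨h.1.add h'.1, fun v => add_mem (h.2 v) (h'.2 v)⟩
  smul_mem' c _ h := ⟨h.1.smul c, fun v => Submodule.smul_mem _ c (h.2 v)⟩

/-- The `k`-forms: finite sums of homogeneous `k`-forms. -/
def Form (k : ℕ) : Submodule ℝ (Raw 𝒜 k) := ⨆ m, FormDeg 𝒜 k m

/-- The space of all differential forms, that is, of functions on the shifted tangent bundle. -/
abbrev Omega := ⨁ k, Form 𝒜 k

variable {𝒜}

theorem form_map {k l : ℕ} (T : Raw 𝒜 k →ₗ[ℝ] Raw 𝒜 l) (n : ℤ)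
    (hT : ∀ m, ∀ η ∈ FormDeg 𝒜 k m, T η ∈ FormDeg 𝒜 l (m + n)) :
    ∀ η ∈ Form 𝒜 k, T η ∈ Form 𝒜 l := fun _ hη =>
  (iSup_le fun m ζ hζ => Submodule.mem_iSup_of_mem (m + n) (hT m ζ hζ) :
    Form 𝒜 k ≤ (Form 𝒜 l).comap T) hη

/-- Contraction `ι_X` of forms with a vector field of degree `n`. -/
def iota {n : ℤ} (X : VF 𝒜 n) (k : ℕ) : Form 𝒜 (k + 1) →ₗ[ℝ] Form 𝒜 k :=
  (rawIota ⟨n, X⟩ k).restrict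
    (form_map _ n fun _ _ h => ⟨h.1.iota _, deg_succ_iff.1 h.2 ⟨n, X⟩⟩)

/-- The de Rham differential. -/
def dR (k : ℕ) : Form 𝒜 k →ₗ[ℝ] Form 𝒜 (k + 1) :=
  LinearMap.restrict ⟨⟨rawD k, rawD_add k⟩, fun c => rawD_smul c k⟩
    (form_map _ 0 fun m _ h => ⟨isForm_rawD h.1, by rw [add_zero]; exact deg_rawD h.2⟩)

/-- The Lie derivative `L_X = ι_X d + (-1)^{|X|} d ι_X`, where `ι_X` vanishes on functions. -/
def lie {n : ℤ} (X : VF 𝒜 n) : ∀ k : ℕ, Form 𝒜 k →ₗ[ℝ] Form 𝒜 k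
  | 0 => iota X 0 ∘ₗ dR 0
  | k + 1 => iota X (k + 1) ∘ₗ dR (k + 1) + gsign n • (dR k ∘ₗ iota X k)

/-- The total differential `d + L_X` on all differential forms. -/
def totalD {n : ℤ} (X : VF 𝒜 n) : Omega 𝒜 →ₗ[ℝ] Omega 𝒜 :=
  DirectSum.toModule ℝ ℕ (Omega 𝒜) fun k =>
    DirectSum.lof ℝ ℕ (fun k => Form 𝒜 k) (k + 1) ∘ₗ dR k +
      DirectSum.lof ℝ ℕ (fun k => Form 𝒜 k) k ∘ₗ lie X k

/-- Functions are the `0`-forms. -/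
def funForm : A ≃ₗ[ℝ] Form 𝒜 0 where
  toFun f := ⟨fun _ => f, by
    refine DirectSum.Decomposition.inductionOn 𝒜
      (motive := fun f => (fun _ => f : Raw 𝒜 0) ∈ Form 𝒜 0) (zero_mem _)
      (fun {i} f => Submodule.mem_iSup_of_mem (p := FormDeg 𝒜 0) i ⟨trivial, fun v => by simp⟩)
      (fun f g hf hg => add_mem hf hg) f⟩
  map_add' _ _ := rfl
  map_smul' _ _ := rfl
  invFun η := (η : Raw 𝒜 0) Fin.elim0
  left_inv _ := rfl
  right_inv η := Subtype.ext (funext fun v => by rw [Subsingleton.elim v Fin.elim0])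

variable (𝒜)

/-- The Euler vector field: `ξ f = k f` for `f` of degree `k`. -/
def euler : VF 𝒜 0 :=
  ⟨DirectSum.toModule ℝ ℤ A (fun k => (k : ℝ) • (𝒜 k).subtype) ∘ₗ
      (DirectSum.decomposeLinearEquiv 𝒜).toLinearMap, by
    set E := DirectSum.toModule ℝ ℤ A (fun k => (k : ℝ) • (𝒜 k).subtype) ∘ₗ
      (DirectSum.decomposeLinearEquiv 𝒜).toLinearMap with hE
    have key : ∀ k, ∀ f ∈ 𝒜 k, E f = (k : ℝ) • f := fun k f hf => by
      lift f to 𝒜 k using hf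
      simp [hE]
    refine ⟨fun k f hf => ?_, fun k f hf g => ?_⟩
    · rw [key k f hf, add_zero]
      exact Submodule.smul_mem _ _ hf
    · rw [zero_mul, gsign_even Even.zero, one_smul, key k f hf]
      refine DirectSum.Decomposition.inductionOn 𝒜
        (motive := fun g => E (f * g) = (k : ℝ) • f * g + f * E g) (by simp)
        (fun {i} g => ?_) (fun g h hg hh => ?_) g
      · rw [key _ _ (SetLike.mul_mem_graded hf g.2), key i g g.2]
        simp only [Int.cast_add, add_smul, smul_mul_assoc, mul_smul_comm]
      · rw [mul_add, map_add, hg, hh, map_add, mul_add, mul_add]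
        abel⟩

variable {𝒜}

/-- A symplectic form of degree `p`: closed, of degree `p` in the sense `L_ξ ω = p ω`, and
non-degenerate, that is, `X ↦ ι_X ω` is a bijection from vector fields (of degree `m - p`) onto
`1`-forms (of degree `m`). -/
structure IsSymplectic (p : ℕ) (ω : Form 𝒜 2) : Prop where
  closed : dR 2 ω = 0
  degree : lie (euler 𝒜) 2 ω = (p : ℝ) • ω
  nondegenerate : ∀ (m : ℤ) (β : Form 𝒜 1), (β : Raw 𝒜 1) ∈ FormDeg 𝒜 1 m →
    ∃! X : VF 𝒜 (m - p), iota X 1 ω = β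

theorem exists_hamiltonian {p : ℕ} {ω : Form 𝒜 2} (hω : IsSymplectic p ω) {q : ℤ} (h : 𝒜 q) :
    ∃! X : VF 𝒜 (q - p), iota X 1 ω = gsign (q + 1) • dR 0 (funForm (h : A)) :=
  hω.nondegenerate q _ (Submodule.smul_mem _ _
    ⟨isForm_rawD (k := 0) trivial, deg_rawD (k := 0) fun v => by simp [funForm]⟩)

/-- The Hamiltonian vector field `X_h` of a function `h` of degree `q`:
`ι_{X_h} ω = (-1)^{q+1} dh`. -/
def hamVF {p : ℕ} {ω : Form 𝒜 2} (hω : IsSymplectic p ω) {q : ℤ} (h : 𝒜 q) : VF 𝒜 (q - p) :=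
  (exists_hamiltonian hω h).choose

/-- The Poisson bracket `{h, g} = X_h(g)`; it is the bracket with `[X_h, X_g] = X_{{h, g}}`. -/
def poisson {p : ℕ} {ω : Form 𝒜 2} (hω : IsSymplectic p ω) {q : ℤ} (h : 𝒜 q) (g : A) : A :=
  (hamVF hω h : Module.End ℝ A) g

end Forms
end GradedCartan

/-! ### Graded manifolds -/

universe u v

/-- The functions on `W` that are smooth in the coordinates `φ`. -/
def smoothFun {M : Type*} [TopologicalSpace M] {n : ℕ}
    (φ : OpenPartialHomeomorph M (EuclideanSpace ℝ (Fin n))) (W : Opens M) :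
    Subalgebra ℝ (W → ℝ) where
  carrier := {g | ∃ F : EuclideanSpace ℝ (Fin n) → ℝ,
    ContDiffOn ℝ (⊤ : ℕ∞) F (φ '' (W : Set M)) ∧ ∀ x : W, g x = F (φ x)}
  mul_mem' := by
    rintro g g' ⟨F, hF, h⟩ ⟨F', hF', h'⟩
    exact ⟨fun y => F y * F' y, hF.mul hF', fun x => by simp [h, h']⟩
  add_mem' := by
    rintro g g' ⟨F, hF, h⟩ ⟨F', hF', h'⟩
    exact ⟨fun y => F y + F' y, hF.add hF', fun x => by simp [h, h']⟩
  algebraMap_mem' c := ⟨fun _ => c, contDiffOn_const, fun _ => rfl⟩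

/-- A sheaf of non-negatively graded, graded commutative real algebras on a topological space;
the sheaf condition is imposed in each degree. -/
structure GradedRingedSpace (M : Type u) [TopologicalSpace M] where
  O : Opens M → Type v
  [ring : ∀ U, Ring (O U)]
  [algebra : ∀ U, Algebra ℝ (O U)]
  deg : ∀ U, ℤ → Submodule ℝ (O U)
  [graded : ∀ U, GradedAlgebra (deg U)]
  [gradedComm : ∀ U, GradedComm (deg U)]
  deg_neg : ∀ U, ∀ k < 0, deg U k = ⊥
  res : ∀ {U V : Opens M}, U ≤ V → O V →ₐ[ℝ] O U
  res_deg : ∀ {U V : Opens M} (h : U ≤ V) (k : ℤ), ∀ f ∈ deg V k, res h f ∈ deg U k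
  res_refl : ∀ (U : Opens M) (f : O U), res le_rfl f = f
  res_trans : ∀ {U V W : Opens M} (h : U ≤ V) (h' : V ≤ W) (f : O W),
    res h (res h' f) = res (h.trans h') f
  glue : ∀ {I : Type u} (U : I → Opens M) (k : ℤ) (s : ∀ i, O (U i)), (∀ i, s i ∈ deg (U i) k) →
    (∀ i j, res (inf_le_left : U i ⊓ U j ≤ U i) (s i) =
      res (inf_le_right : U i ⊓ U j ≤ U j) (s j)) →
    ∃! t : O (⨆ i, U i), t ∈ deg (⨆ i, U i) k ∧ ∀ i, res (le_iSup U i) t = s i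

attribute [instance] GradedRingedSpace.ring GradedRingedSpace.algebra GradedRingedSpace.graded
  GradedRingedSpace.gradedComm

/-- Exponents of monomials in generators of degrees `d`: odd generators occur at most once. -/
def MonomialIndex {r : ℕ} (d : Fin r → ℕ) : Type := {e : Fin r → ℕ // ∀ j, Odd (d j) → e j ≤ 1}

/-- A chart of a graded ringed space: coordinates `φ` on an open subset `U`, an identification of
the functions of degree `0` over each open `W ⊆ U` with the smooth functions on `W`, and finitely
many generators `θ j` of positive degrees `d j` over `U` such that every function over `W` is
uniquely a polynomial in the `θ j` with smooth coefficients, i.e.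
`O(W) = C^∞(W) ⊗ S(θ₁, …, θᵣ)`. -/
structure GradedChart {M : Type u} [TopologicalSpace M] (S : GradedRingedSpace.{u, v} M) where
  n : ℕ
  r : ℕ
  d : Fin r → ℕ
  d_pos : ∀ j, 0 < d j
  φ : OpenPartialHomeomorph M (EuclideanSpace ℝ (Fin n))
  U : Opens M
  U_eq : (U : Set M) = φ.source
  coeff : ∀ W : Opens M, W ≤ U → smoothFun φ W →ₐ[ℝ] S.O W
  coeff_injective : ∀ W h, Function.Injective (coeff W h)
  coeff_range : ∀ W h, Set.range (coeff W h) = S.deg W 0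
  coeff_res : ∀ (V W : Opens M) (hV : V ≤ U) (hWV : W ≤ V) (g : smoothFun φ V)
    (g' : smoothFun φ W), (∀ x : W, (g' : W → ℝ) x = (g : V → ℝ) ⟨x, hWV x.2⟩) →
    S.res hWV (coeff V hV g) = coeff W (hWV.trans hV) g'
  θ : Fin r → S.O U
  θ_deg : ∀ j, θ j ∈ S.deg U (d j)
  polynomial : ∀ (W : Opens M) (h : W ≤ U), Function.Bijective
    fun a : MonomialIndex d →₀ smoothFun φ W =>
      a.sum fun e g => coeff W h g * (List.ofFn fun j => S.res h (θ j) ^ e.1 j).prod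

/-- A (non-negatively graded) graded manifold: a Hausdorff second countable space with a sheaf of
graded algebras that is covered by charts. Since there are partitions of unity in degree `0`, vector
fields and differential forms are determined by the algebra of global functions. -/
structure GradedManifold where
  M : Type u
  [topology : TopologicalSpace M]
  [t2 : T2Space M]
  [secondCountable : SecondCountableTopology M]
  S : GradedRingedSpace.{u, v} M
  exists_chart : ∀ x : M, ∃ c : GradedChart S, x ∈ c.U

attribute [instance] GradedManifold.topology

namespace GradedManifold

/-- The global functions. -/
abbrev Fun (𝒮 : GradedManifold.{u, v}) : Type v := 𝒮.S.O ⊤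

/-- The global functions of degree `k`. -/
abbrev funDeg (𝒮 : GradedManifold.{u, v}) (k : ℤ) : Submodule ℝ 𝒮.Fun := 𝒮.S.deg ⊤ k

/-- The vector fields of degree `n`. -/
abbrev VF (𝒮 : GradedManifold.{u, v}) (n : ℤ) : Submodule ℝ (Module.End ℝ 𝒮.Fun) :=
  GradedCartan.VF 𝒮.funDeg n

/-- The Euler vector field. -/
abbrev euler (𝒮 : GradedManifold.{u, v}) : 𝒮.VF 0 := GradedCartan.euler 𝒮.funDeg

/-- The differential `k`-forms. -/
abbrev Form (𝒮 : GradedManifold.{u, v}) (k : ℕ) : Submodule ℝ (GradedCartan.Raw 𝒮.funDeg k) :=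
  GradedCartan.Form 𝒮.funDeg k

/-- A form of order `k` as an element of the space of all differential forms. -/
abbrev incl (𝒮 : GradedManifold.{u, v}) (k : ℕ) :
    𝒮.Form k →ₗ[ℝ] GradedCartan.Omega 𝒮.funDeg :=
  DirectSum.lof ℝ ℕ (fun k => 𝒮.Form k) k

end GradedManifold

end

namespace GradedCartan

section HomologicalSymplectic

variable {A : Type*} [Ring A] [Algebra ℝ A] {𝒜 : ℤ → Submodule ℝ A}

/-! The proof is Cartan calculus with two vector fields, `ξ` and `Q`. Since `[ξ, X] = |X| X`,
contraction with `X` shifts `L_ξ`-eigenvalues by `|X|`, so `ω` and `ι_Q ω` have eigenvalues `p` and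
`p + 1`. Both are closed, the second because `L_Q ω = 0`. On closed forms `L_ξ = d ι_ξ`, so `ι_ξ`
produces primitives after division by `p` and `p + 1`: the first is `α`, the second is `𝒬` up to a
sign, because `ι_ξ` and `ι_Q` commute. Non-degeneracy then identifies `Q` with the Hamiltonian field
of `𝒬`. Because `L_Q` commutes with `ι_Q`, the function `ι_Q ι_Q ω`, equal to `Q 𝒬` up to sign, has
zero differential. Its degree `p + 2` is nonzero, so it vanishes, and this is `{𝒬, 𝒬} = 0`. Finally
`(d + L_Q)(α + c 𝒬)` has components `d α = ω`, `L_Q α + c d𝒬` and `c Q 𝒬 = 0`; the value `c = (-1)^p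
/ p` cancels the middle one. The main tools are `lie_iota_of_bracket`, `mem_of_euler_eq`,
`eq_zero_of_dR_eq_zero` and `IsSymplectic.dR_iota_euler_iota`. -/

theorem gsign_mul_self (n : ℤ) : gsign n * gsign n = 1 := by
  rw [← gsign_add]
  exact gsign_even ⟨n, rfl⟩

theorem gsign_natCast (p : ℕ) : gsign p = (-1) ^ p := zpow_natCast _ _

/-! ### The Euler field and homogeneity. -/

variable [GradedAlgebra 𝒜]

theorem euler_apply {k : ℤ} {f : A} (hf : f ∈ 𝒜 k) :
    (euler 𝒜 : Module.End ℝ A) f = (k : ℝ) • f := by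
  lift f to 𝒜 k using hf
  simp [euler]

theorem euler_decompose (f : A) (k : ℤ) :
    (decompose 𝒜 ((euler 𝒜 : Module.End ℝ A) f) k : A) = (k : ℝ) • (decompose 𝒜 f k : A) := by
  refine DirectSum.Decomposition.inductionOn 𝒜
    (motive := fun f => (decompose 𝒜 ((euler 𝒜 : Module.End ℝ A) f) k : A) =
      (k : ℝ) • (decompose 𝒜 f k : A)) (by simp) (fun {i} f => ?_) (fun f g hf hg => ?_) f
  · rw [euler_apply f.2, decompose_smul, DirectSum.smul_apply, Submodule.coe_smul]
    by_cases h : i = k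
    · subst h
      rfl
    · rw [decompose_of_mem_ne 𝒜 f.2 h, smul_zero, smul_zero]
  · simp only [map_add, decompose_add, DirectSum.add_apply, Submodule.coe_add, hf, hg, smul_add]

/-- An eigenvector of the Euler field with eigenvalue `m` is homogeneous of degree `m`. -/
theorem mem_of_euler_eq {m : ℤ} {f : A} (h : (euler 𝒜 : Module.End ℝ A) f = (m : ℝ) • f) :
    f ∈ 𝒜 m := by
  -- Comparing components of degree `k` gives `(m - k) f_k = 0`.
  have h0 : ∀ k, k ≠ m → (decompose 𝒜 f k : A) = 0 := fun k hk => by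
    have e := euler_decompose (𝒜 := 𝒜) f k
    rw [h, decompose_smul, DirectSum.smul_apply, Submodule.coe_smul, ← sub_eq_zero,
      ← sub_smul] at e
    refine (smul_eq_zero.1 e).resolve_left (sub_ne_zero.2 ?_)
    exact_mod_cast hk.symm
  classical
  rw [← sum_support_decompose 𝒜 f]
  refine sum_mem fun k _ => ?_
  by_cases hk : k = m
  · exact hk ▸ (decompose 𝒜 f k).2
  · rw [h0 k hk]
    exact zero_mem _

/-- The commutator of the Euler field with a vector field of degree `n`: `[ξ, X] = n X`. -/
theorem euler_commutator {n : ℤ} (X : VF 𝒜 n) :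
    (euler 𝒜 : Module.End ℝ A) * X - (X : Module.End ℝ A) * (euler 𝒜 : Module.End ℝ A) =
      (n : ℝ) • (X : Module.End ℝ A) := by
  ext f
  refine DirectSum.Decomposition.inductionOn 𝒜
    (motive := fun f => ((euler 𝒜 : Module.End ℝ A) * X -
      (X : Module.End ℝ A) * (euler 𝒜 : Module.End ℝ A)) f =
      ((n : ℝ) • (X : Module.End ℝ A)) f) (by simp) (fun {i} f => ?_) (fun f g hf hg => ?_) f
  · simp only [LinearMap.sub_apply, Module.End.mul_apply, LinearMap.smul_apply,
      euler_apply f.2, euler_apply (X.2.1 i f f.2), map_smul, ← sub_smul]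
    push_cast
    rw [add_sub_cancel_left]
  · rw [map_add, map_add, hf, hg]

/-! ### Commutation relations between `d`, `ι` and `L`. -/

variable [GradedComm 𝒜]

/-- A form is only a finite sum of homogeneous ones, but tensoriality and graded symmetry survive
sums. -/
theorem isForm_coe {k : ℕ} (η : Form 𝒜 k) : IsForm k (η : Raw 𝒜 k) :=
  Submodule.iSup_induction (FormDeg 𝒜 k) (motive := IsForm k) η.2 (fun _ _ h => h.1)
    (isForm_zero k) (fun _ _ h h' => h.add h')

theorem coe_iota {n : ℤ} (X : VF 𝒜 n) (k : ℕ) (η : Form 𝒜 (k + 1)) :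
    (iota X k η : Raw 𝒜 k) = rawIota ⟨n, X⟩ k η := rfl

theorem coe_dR (k : ℕ) (η : Form 𝒜 k) : (dR k η : Raw 𝒜 (k + 1)) = rawD k η := rfl

theorem lie_succ_apply {n : ℤ} (X : VF 𝒜 n) (k : ℕ) (η : Form 𝒜 (k + 1)) :
    lie X (k + 1) η = iota X (k + 1) (dR (k + 1) η) + gsign n • dR k (iota X k η) := rfl

/-- `lie` comes from Cartan's formula and `rawLie` from the commutator with contractions; `rawD` was
built to make them agree. This gives `lie` the commutator relation. -/
theorem coe_lie {n : ℤ} (X : VF 𝒜 n) : ∀ (k : ℕ) (η : Form 𝒜 k),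
    (lie X k η : Raw 𝒜 k) = rawLie ⟨n, X⟩ k η
  | 0, _ => rfl
  | k + 1, η => by
      rw [lie_succ_apply, Submodule.coe_add, Submodule.coe_smul, coe_iota, coe_dR, coe_dR,
        coe_iota, rawIota_rawD, sub_add_cancel]

/-- Contraction of `df` with `X` is `X f`. -/
theorem iota_dR_funForm {n : ℤ} (X : VF 𝒜 n) (f : A) :
    iota X 0 (dR 0 (funForm f : Form 𝒜 0)) = funForm ((X : Module.End ℝ A) f) := rfl

theorem lie_funForm {n : ℤ} (X : VF 𝒜 n) (f : A) :
    lie X 0 (funForm f : Form 𝒜 0) = funForm ((X : Module.End ℝ A) f) := rfl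

/-- Contractions commute up to the sign `(-1)^{(|X|-1)(|Y|-1)}`. -/
theorem iota_iota {m n : ℤ} (X : VF 𝒜 m) (Y : VF 𝒜 n) (k : ℕ) (η : Form 𝒜 (k + 2)) :
    iota Y k (iota X (k + 1) η) = gsign ((m - 1) * (n - 1)) • iota X k (iota Y (k + 1) η) :=
  Subtype.ext ((isForm_coe η).2 ⟨m, X⟩ ⟨n, Y⟩)

/-- The commutator `[L_X, ι_Y] = ι_{[X,Y]}` when `[X, Y]` is a multiple of a vector field `Z` of
degree `|X| + |Y|`. -/
theorem lie_iota_of_bracket {l m n : ℤ} (X : VF 𝒜 m) (Y : VF 𝒜 n) (hl : m + n = l)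
    (Z : VF 𝒜 l) (c : ℝ)
    (h : (X : Module.End ℝ A) * Y - gsign (m * n) • ((Y : Module.End ℝ A) * X) =
      c • (Z : Module.End ℝ A)) (k : ℕ) (η : Form 𝒜 (k + 1)) :
    lie X k (iota Y k η) =
      gsign (m * (n - 1)) • iota Y k (lie X (k + 1) η) + c • iota Z k η := by
  refine Subtype.ext ?_
  simp only [Submodule.coe_add, Submodule.coe_smul, coe_iota, coe_lie, rawIota_rawLie]
  -- The recursion for `ι_Y L_X` is solved for `L_X ι_Y`, its sign being its own inverse;
  -- `first_smul` then pulls the constant out of the contraction with the bracket.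
  rw [smul_smul, gsign_mul_self, one_smul,
    (isForm_coe η).first_smul (X := bracket ⟨m, X⟩ ⟨n, Y⟩) (Y := ⟨l, Z⟩) c hl h,
    sub_add_cancel]

/-- A function of nonzero degree with vanishing differential is zero. -/
theorem eq_zero_of_dR_eq_zero {m : ℤ} (hm : m ≠ 0) {f : A} (hf : f ∈ 𝒜 m)
    (h : dR 0 (funForm f : Form 𝒜 0) = 0) : f = 0 := by
  -- Contracting `df = 0` with the Euler field gives `m f = 0`.
  have e := iota_dR_funForm (euler 𝒜) f
  rw [h, map_zero, euler_apply hf, eq_comm, LinearEquiv.map_eq_zero_iff] at e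
  exact (smul_eq_zero.1 e).resolve_left (by exact_mod_cast hm)

theorem lie_euler_iota {n : ℤ} (X : VF 𝒜 n) (k : ℕ) (η : Form 𝒜 (k + 1)) :
    lie (euler 𝒜) k (iota X k η) =
      iota X k (lie (euler 𝒜) (k + 1) η) + (n : ℝ) • iota X k η := by
  have := lie_iota_of_bracket (euler 𝒜) X (zero_add n) X n (by
    rw [zero_mul, gsign_even Even.zero, one_smul, euler_commutator]) k η
  rwa [zero_mul, gsign_even Even.zero, one_smul] at this

/-- The Lie derivative along a vector field `Q` of degree `1` with `Q² = 0` commutes with `ι_Q`. -/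
theorem lie_iota_self {Q : VF 𝒜 1} (hQ : (Q : Module.End ℝ A) * Q = 0) (k : ℕ)
    (η : Form 𝒜 (k + 1)) : lie Q k (iota Q k η) = iota Q k (lie Q (k + 1) η) := by
  -- The graded commutator is `[Q, Q] = 2 Q² = 0`, so the bracket term is taken with zero field and
  -- zero coefficient.
  have := lie_iota_of_bracket Q Q rfl 0 0 (by rw [hQ]; simp) k η
  rwa [zero_smul, add_zero, show (1 : ℤ) * (1 - 1) = 0 by norm_num, gsign_even Even.zero,
    one_smul] at this

theorem totalD_lof {n : ℤ} (X : VF 𝒜 n) (k : ℕ) (η : Form 𝒜 k) :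
    totalD X (lof ℝ ℕ (fun k => Form 𝒜 k) k η) =
      lof ℝ ℕ (fun k => Form 𝒜 k) (k + 1) (dR k η) +
        lof ℝ ℕ (fun k => Form 𝒜 k) k (lie X k η) := by
  rw [totalD, toModule_lof]
  rfl

/-- The hypotheses kill the components of order `0` and `1`, leaving only the one of order `2`. -/
theorem totalD_lof_add {n : ℤ} {X : VF 𝒜 n} {β : Form 𝒜 1} {f : A} {c : ℝ}
    (hf : (X : Module.End ℝ A) f = 0) (h : lie X 1 β + c • dR 0 (funForm f) = 0) :
    totalD X (lof ℝ ℕ (fun k => Form 𝒜 k) 1 β +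
      c • lof ℝ ℕ (fun k => Form 𝒜 k) 0 (funForm f)) =
      lof ℝ ℕ (fun k => Form 𝒜 k) 2 (dR 1 β) := by
  rw [map_add, map_smul, totalD_lof, totalD_lof, lie_funForm, hf, map_zero, map_zero, add_zero,
    add_assoc, ← map_smul, ← map_add, h, map_zero, add_zero]

/-! ### Closed contractions of a symplectic form and their primitives. -/

section Symplectic

variable {p : ℕ} {ω : Form 𝒜 2}

theorem IsSymplectic.dR_iota_euler (hω : IsSymplectic p ω) :
    dR 1 (iota (euler 𝒜) 1 ω) = (p : ℝ) • ω := by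
  have h := hω.degree
  rwa [lie_succ_apply, hω.closed, map_zero, zero_add, gsign_even Even.zero, one_smul] at h

theorem IsSymplectic.dR_iota {n : ℤ} {X : VF 𝒜 n} (hω : IsSymplectic p ω)
    (hX : lie X 2 ω = 0) : dR 1 (iota X 1 ω) = 0 := by
  rw [lie_succ_apply, hω.closed, map_zero, zero_add] at hX
  have := congrArg (fun η => gsign n • η) hX
  simpa only [smul_smul, gsign_mul_self, one_smul, smul_zero] using this

/-- A symplectic vector field `X` of degree `n` satisfies `d ι_ξ ι_X ω = (p + n) ι_X ω`. -/
theorem IsSymplectic.dR_iota_euler_iota {n : ℤ} {X : VF 𝒜 n} (hω : IsSymplectic p ω)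
    (hX : lie X 2 ω = 0) :
    dR 0 (iota (euler 𝒜) 0 (iota X 1 ω)) = ((p : ℝ) + n) • iota X 1 ω := by
  -- The form `ι_X ω` is closed with `L_ξ`-eigenvalue `p + n`, and Cartan's formula keeps only `d
  -- ι_ξ`.
  have h := lie_euler_iota X 1 ω
  rwa [lie_succ_apply, hω.dR_iota hX, map_zero, zero_add, gsign_even Even.zero, one_smul,
    hω.degree, map_smul, ← add_smul] at h

/-- Commuting `L_Q` past `ι_Q` gives `L_Q ι_Q ω = 0`; as `ι_Q ω` is closed, only the `d ι_Q` term of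
Cartan's formula is left. -/
theorem IsSymplectic.dR_iota_iota_self {Q : VF 𝒜 1} (hω : IsSymplectic p ω)
    (hQ : (Q : Module.End ℝ A) * Q = 0) (hQω : lie Q 2 ω = 0) :
    dR 0 (iota Q 0 (iota Q 1 ω)) = 0 := by
  have h := lie_iota_self hQ 1 ω
  rw [hQω, map_zero, lie_succ_apply, hω.dR_iota hQω, map_zero, zero_add] at h
  have := congrArg (fun η => gsign 1 • η) h
  simpa only [smul_smul, gsign_mul_self, one_smul, smul_zero] using this

/-- The degrees agree only propositionally (`1` against `(p + 1) - p` in the application), so the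
fields are compared as endomorphisms. -/
theorem IsSymplectic.hamVF_eq (hω : IsSymplectic p ω) {q n : ℤ} (hn : n = q - p) (h : 𝒜 q)
    {X : VF 𝒜 n} (hX : iota X 1 ω = gsign (q + 1) • dR 0 (funForm (h : A))) :
    (X : Module.End ℝ A) = hamVF hω h := by
  subst hn
  have hu := exists_hamiltonian hω h
  rw [hu.unique hX hu.choose_spec.1]
  rfl

end Symplectic

end HomologicalSymplectic

end GradedCartan

/-! ### The Hamiltonian of `Q` and the primitive of `ω`. -/

theorem mainTheorem6 (𝒮 : GradedManifold) (Q : 𝒮.VF 1)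
    (hQ : (Q : Module.End ℝ 𝒮.Fun) * Q = 0) (p : ℕ) (hp : 0 < p) (ω : 𝒮.Form 2)
    (hω : GradedCartan.IsSymplectic p ω) (hQω : GradedCartan.lie Q 2 ω = 0) :
    let α : 𝒮.Form 1 := (1 / p : ℝ) • GradedCartan.iota 𝒮.euler 1 ω
    let 𝒬 : 𝒮.Fun := ((p / (p + 1) : ℝ) * (-1) ^ p) •
      GradedCartan.funForm.symm (GradedCartan.iota Q 0 α)
    let αhat : GradedCartan.Omega 𝒮.funDeg :=
      𝒮.incl 1 α + ((-1) ^ p / p : ℝ) • 𝒮.incl 0 (GradedCartan.funForm 𝒬)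
    GradedCartan.dR 1 α = ω ∧
    (∃ h𝒬 : 𝒬 ∈ 𝒮.funDeg (p + 1),
      (Q : Module.End ℝ 𝒮.Fun) = GradedCartan.hamVF hω ⟨𝒬, h𝒬⟩ ∧
      GradedCartan.poisson hω ⟨𝒬, h𝒬⟩ 𝒬 = 0) ∧
    GradedCartan.iota Q 1 ω = ((-1) ^ p : ℝ) • GradedCartan.dR 0 (GradedCartan.funForm 𝒬) ∧
    αhat = (1 / p : ℝ) • (𝒮.incl 1 (GradedCartan.iota 𝒮.euler 1 ω) +
      (1 / (p + 1) : ℝ) •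
        𝒮.incl 0 (GradedCartan.iota Q 0 (GradedCartan.iota 𝒮.euler 1 ω))) ∧
    GradedCartan.totalD Q αhat = 𝒮.incl 2 ω := by
  intro α 𝒬 αhat
  have hp' : (p : ℝ) ≠ 0 := by exact_mod_cast hp.ne'
  have hp1 : (p : ℝ) + 1 ≠ 0 := by positivity
  have hs : ((-1 : ℝ) ^ p) * (-1) ^ p = 1 := by rw [← mul_pow]; simp
  have hdα : GradedCartan.dR 1 α = ω := by
    rw [map_smul, hω.dR_iota_euler, smul_smul, one_div_mul_cancel hp', one_smul]
  have hcomm : GradedCartan.iota Q 0 (GradedCartan.iota 𝒮.euler 1 ω) =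
      GradedCartan.iota 𝒮.euler 0 (GradedCartan.iota Q 1 ω) := by
    -- The sign exponent is `(0 - 1)(1 - 1) = 0`.
    rw [GradedCartan.iota_iota]
    simp [GradedCartan.gsign_even]
  have h𝒬form : GradedCartan.funForm 𝒬 = ((-1) ^ p / (p + 1) : ℝ) •
      GradedCartan.iota 𝒮.euler 0 (GradedCartan.iota Q 1 ω) := by
    rw [map_smul, LinearEquiv.apply_symm_apply, map_smul, hcomm, smul_smul]
    congr 1
    field_simp
  have hd𝒬 : GradedCartan.dR 0 (GradedCartan.funForm 𝒬) =
      ((-1) ^ p : ℝ) • GradedCartan.iota Q 1 ω := by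
    rw [h𝒬form, map_smul, hω.dR_iota_euler_iota hQω, smul_smul, Int.cast_one,
      div_mul_cancel₀ _ hp1]
  have hιω : GradedCartan.iota Q 1 ω =
      ((-1) ^ p : ℝ) • GradedCartan.dR 0 (GradedCartan.funForm 𝒬) := by
    rw [hd𝒬, smul_smul, hs, one_smul]
  have h𝒬 : 𝒬 ∈ 𝒮.funDeg (p + 1) := by
    -- The degree is read off from `ξ 𝒬 = ι_ξ d𝒬 = (-1)^p ι_ξ ι_Q ω = (p + 1) 𝒬`.
    refine GradedCartan.mem_of_euler_eq
      ((GradedCartan.funForm (𝒜 := 𝒮.funDeg)).injective ?_)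
    rw [← GradedCartan.iota_dR_funForm, hd𝒬, map_smul, map_smul, h𝒬form, smul_smul]
    congr 1
    push_cast
    field_simp
  have hham : (Q : Module.End ℝ 𝒮.Fun) = GradedCartan.hamVF hω ⟨𝒬, h𝒬⟩ := by
    refine hω.hamVF_eq (by ring) ⟨𝒬, h𝒬⟩ ?_
    -- The Hamiltonian sign has exponent `(p + 1) + 1`, of the same parity as `p`.
    rw [hιω, GradedCartan.gsign_congr (n := (p : ℤ)) ⟨1, by ring⟩, GradedCartan.gsign_natCast]
  have hQ𝒬 : (Q : Module.End ℝ 𝒮.Fun) 𝒬 = 0 := by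
    refine GradedCartan.eq_zero_of_dR_eq_zero (𝒜 := 𝒮.funDeg) (m := p + 1 + 1) (by omega)
      (Q.2.1 _ _ h𝒬) ?_
    rw [← GradedCartan.iota_dR_funForm, hd𝒬, map_smul, map_smul, hω.dR_iota_iota_self hQ hQω, smul_zero]
  have hdια : GradedCartan.dR 0 (GradedCartan.iota Q 0 α) =
      ((p + 1) / p : ℝ) • GradedCartan.iota Q 1 ω := by
    rw [map_smul, map_smul, hcomm, hω.dR_iota_euler_iota hQω, smul_smul, Int.cast_one]
    congr 1
    ring
  -- With `L_Q α = ι_Q d α - d ι_Q α`, the coefficients of `ι_Q ω` add up to `1 - (p + 1)/p + 1/p =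
  -- 0`.
  have hLα : GradedCartan.lie Q 1 α +
      ((-1) ^ p / p : ℝ) • GradedCartan.dR 0 (GradedCartan.funForm 𝒬) = 0 := by
    rw [GradedCartan.lie_succ_apply, hdα, hdια, hd𝒬, GradedCartan.gsign_odd odd_one,
      smul_smul, smul_smul, div_mul_eq_mul_div, hs]
    nth_rewrite 1 [← one_smul ℝ (GradedCartan.iota Q 1 ω)]
    rw [← add_smul, ← add_smul]
    convert zero_smul ℝ _
    field_simp
    ring
  refine ⟨hdα, ⟨h𝒬, hham, ?_⟩, hιω, ?_, ?_⟩
  · rw [GradedCartan.poisson, ← hham, hQ𝒬]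
  · simp only [αhat, α]
    rw [h𝒬form, hcomm, map_smul, map_smul, smul_add, smul_smul, smul_smul]
    congr 2
    rw [div_mul_div_comm, hs, div_mul_div_comm, one_mul]
  · rw [GradedCartan.totalD_lof_add hQ𝒬 hLα, hdα]
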